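/- A circular arc of radius $r>0$ with centre $O$ in the plane is a set $\{O+re^{i\theta} : \alpha\le\theta\le\beta\}$ with $0<\beta-\alpha<2\pi$. Given a finite family of pairwise disjoint circular arcs with the same centre $O$, its visibility graph has the arcs as its vertices, and two distinct arcs $a,b$ are adjacent if and only if there is a line segment with one endpoint on $a$ and the other on $b$ that lies on a line through $O$ (the segment may contain $O$) and meets no arc of the family other than $a$ and $b$. A graph is an arc visibility graph if it is isomorphic to the visibility graph of such a family. It is a semi-arc visibility graph if the family can moreover be chosen such that all its arcs extend counterclockwise from one and the same ray emanating from $O$ (that is, they all have the same initial argument $\alpha$). Theorem. Every semi-arc visibility graph is planar. In contrast, arc visibility graphs need not be planar: the complete graph $K_5$ is an arc visibility graph, and $K_5$ is not planar. -/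

import Mathlib

/-- A circular arc in the plane `ℂ` with centre at the origin: it has positive radius and extends
counterclockwise from argument `negArg` (negative endpoint) to argument `posArg`
(positive endpoint), where `0 < posArg - negArg < 2π`. -/
structure CircArc where
  radius : ℝ
  negArg : ℝ
  posArg : ℝ
  radius_pos : 0 < radius
  neg_lt_pos : negArg < posArg
  pos_lt : posArg < negArg + 2 * Real.pi

/-- The (closed) set of points of the arc. -/
def CircArc.points (a : CircArc) : Set ℂ :=
  (fun θ : ℝ => (a.radius : ℂ) * Complex.exp (θ * Complex.I)) '' Set.Icc a.negArg a.posArg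

/-- The arcs `A u` and `A v` are joined by a radial line of sight, i.e. by a segment lying on a
line through the centre (the segment itself may pass through the centre), which meets at most `k`
of the other arcs. Each other arc is counted once, however often the segment meets it. -/
def Sees {V : Type*} (k : ℕ) (A : V → CircArc) (u v : V) : Prop :=
  ∃ p ∈ (A u).points, ∃ q ∈ (A v).points, Collinear ℝ {0, p, q} ∧
    {w : V | w ≠ u ∧ w ≠ v ∧ ((A w).points ∩ segment ℝ p q).Nonempty}.encard ≤ k

theorem Sees.symm {V : Type*} {k : ℕ} {A : V → CircArc} {u v : V} (h : Sees k A u v) :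
    Sees k A v u := by
  obtain ⟨p, hp, q, hq, hc, hk⟩ := h
  refine ⟨q, hq, p, hp, ?_, ?_⟩
  · rwa [Set.pair_comm]
  · have e : {w : V | w ≠ v ∧ w ≠ u ∧ ((A w).points ∩ segment ℝ q p).Nonempty} =
        {w : V | w ≠ u ∧ w ≠ v ∧ ((A w).points ∩ segment ℝ p q).Nonempty} := by
      ext w
      simp only [Set.mem_ofPred_eq, segment_symm ℝ q p]
      tauto
    rwa [e]

/-- The `k`-visibility graph of a family of concentric arcs. -/
def arcVisibilityGraph {V : Type*} (k : ℕ) (A : V → CircArc) : SimpleGraph V where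
  Adj u v := u ≠ v ∧ Sees k A u v
  symm := ⟨fun _ _ h => ⟨h.1.symm, h.2.symm⟩⟩
  loopless := ⟨fun _ h => h.1 rfl⟩

/-- `G` is an arc `k`-visibility graph: it is the `k`-visibility graph of a family of pairwise
nonintersecting concentric arcs. -/
def IsArcVisibilityGraph {V : Type*} (k : ℕ) (G : SimpleGraph V) : Prop :=
  ∃ A : V → CircArc,
    (∀ u v, u ≠ v → Disjoint (A u).points (A v).points) ∧ G = arcVisibilityGraph k A

/-- `G` is a semi-arc `k`-visibility graph: it is the `k`-visibility graph of a family of pairwise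
nonintersecting concentric arcs that all extend counterclockwise from one radial ray. -/
def IsSemiArcVisibilityGraph {V : Type*} (k : ℕ) (G : SimpleGraph V) : Prop :=
  ∃ A : V → CircArc,
    (∀ u v, u ≠ v → Disjoint (A u).points (A v).points) ∧
    (∃ α : ℝ, ∀ v, (A v).negArg = α) ∧ G = arcVisibilityGraph k A

/-- A planar embedding of a graph: the vertices are distinct points of the plane, every edge is a
simple (injective, continuous) curve joining the points of its two ends, and no interior point of
an edge is a vertex or an interior point of another edge. -/
structure PlanarEmbedding {V : Type*} (G : SimpleGraph V) where
  vertex : V → ℂ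
  edge : G.edgeSet → C(unitInterval, ℂ)
  vertex_injective : Function.Injective vertex
  edge_injective : ∀ e, Function.Injective (edge e)
  edge_ends : ∀ e, s(edge e 0, edge e 1) = Sym2.map vertex (e : Sym2 V)
  edge_ne_vertex : ∀ e, ∀ t ∈ Set.Ioo (0 : unitInterval) 1, ∀ v, edge e t ≠ vertex v
  edge_ne_edge : ∀ e e', e ≠ e' → ∀ t ∈ Set.Ioo (0 : unitInterval) 1,
    ∀ t' ∈ Set.Ioo (0 : unitInterval) 1, edge e t ≠ edge e' t'

/-- A graph is planar if it has a planar embedding. -/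
def IsPlanar {V : Type*} (G : SimpleGraph V) : Prop :=
  Nonempty (PlanarEmbedding G)

/-! ### Non-planarity of `K₅` -/

/-! Semi-arcs: all arcs start on one ray, so a ray meets an arc as soon as the arc's end argument
reaches it, and visibility depends only on radii and end arguments. Every sight line either can be
replaced by one along a single ray (`DirectSight`) or is a genuine one through the centre
(`CentralSight`). Comparing end arguments shows that direct sights never interlace in the order of
radii, that the larger end of a central sight is never strictly inside a direct one, and that
central sights are not strictly nested. Hence, with vertices on a generatrix of a cylinder in order
of radius, direct sights can be drawn as low caps and central sights as curves winding once around
(`isPlanar_of_cylindrical`).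

Non-planarity of `K₅` is a parity count. For disjoint curves `γ`, `δ` the difference `γ s - δ t` has
a continuous logarithm on the whole parameter square, so its increments around the boundary cancel.
Each of the 15 pairs of disjoint edges thus yields an integer equation between winding numbers of
edges about vertices; the sum of the 15 equations is impossible mod 2. -/

open Complex in
/-- A nowhere vanishing continuous function on a contractible, locally path connected space has
a continuous logarithm. -/
theorem exists_continuous_log {X : Type*} [TopologicalSpace X] [SimplyConnectedSpace X]
    [LocallyPathConnectedSpace X] {f : X → ℂ} (hf : Continuous f) (h0 : ∀ x, f x ≠ 0) :
    ∃ l : X → ℂ, Continuous l ∧ ∀ x, exp (l x) = f x := by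
  obtain ⟨x₀⟩ : Nonempty X := inferInstance
  obtain ⟨F, ⟨-, hF⟩, -⟩ := isCoveringMapOn_exp.existsUnique_continuousMap_lifts
    (⟨f, hf⟩ : C(X, ℂ)) (exp_log (h0 x₀)) h0
  exact ⟨F, F.continuous, fun x => congrFun hF x⟩

-- Lifts through `exp` are determined by their initial value, and translating `g` by `h 0 - g 0`
-- gives a lift that starts where `h` does.
open Complex in
theorem log_increment_unique {g h : ℝ → ℂ} (hg : Continuous g) (hh : Continuous h)
    (e : ∀ t, exp (g t) = exp (h t)) : g 1 - g 0 = h 1 - h 0 := by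
  have h0 : ∀ t, exp (h t) ≠ 0 := fun t => exp_ne_zero _
  obtain ⟨F, -, hu⟩ := isCoveringMapOn_exp.existsUnique_continuousMap_lifts
    (⟨fun t => exp (h t), by fun_prop⟩ : C(ℝ, ℂ)) (a₀ := (0 : ℝ)) (e₀ := h 0) rfl h0
  have e1 := hu ⟨h, hh⟩ ⟨rfl, rfl⟩
  have e2 := hu ⟨fun t => g t - g 0 + h 0, by fun_prop⟩ ⟨by simp, by
    ext t
    simp only [ContinuousMap.coe_mk, Function.comp_apply]
    rw [exp_add, exp_sub, e t, e 0, div_mul_cancel₀ _ (exp_ne_zero _)]⟩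
  have e3 := congrArg (fun G : C(ℝ, ℂ) => G 1) (e2.trans e1.symm)
  simp only [ContinuousMap.coe_mk] at e3
  linear_combination e3

open Complex in
/-- If the differences of two curves never vanish, the increments of the logarithm of the
difference along the four sides of the square add up to zero. -/
theorem log_increment_square {γ δ : ℝ → ℂ} (hγ : Continuous γ) (hδ : Continuous δ)
    (hne : ∀ s t, γ s ≠ δ t) {l₁ l₂ l₃ l₄ : ℝ → ℂ}
    (c₁ : Continuous l₁) (c₂ : Continuous l₂) (c₃ : Continuous l₃) (c₄ : Continuous l₄)
    (h₁ : ∀ t, exp (l₁ t) = γ t - δ 0) (h₂ : ∀ t, exp (l₂ t) = δ t - γ 1)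
    (h₃ : ∀ t, exp (l₃ t) = γ t - δ 1) (h₄ : ∀ t, exp (l₄ t) = δ t - γ 0) :
    (l₁ 1 - l₁ 0) + (l₂ 1 - l₂ 0) = (l₃ 1 - l₃ 0) + (l₄ 1 - l₄ 0) := by
  -- One logarithm of `γ s - δ t` on the parameter plane serves all four sides. Two sides involve
  -- the opposite difference; the shift by `π * I` drops out of the increments.
  obtain ⟨M, cM, hM⟩ := exists_continuous_log (X := ℝ × ℝ) (f := fun p => γ p.1 - δ p.2)
    (by fun_prop) (fun p => sub_ne_zero.2 (hne _ _))
  have neg : ∀ z, exp (z + Real.pi * I) = - exp z := fun z => by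
    rw [exp_add, exp_pi_mul_I]; ring
  have e₁ := log_increment_unique c₁ (h := fun t => M (t, 0)) (by fun_prop)
    (fun t => by rw [h₁, hM])
  have e₃ := log_increment_unique c₃ (h := fun t => M (t, 1)) (by fun_prop)
    (fun t => by rw [h₃, hM])
  have e₂ := log_increment_unique c₂ (h := fun t => M (1, t) + Real.pi * I) (by fun_prop)
    (fun t => by rw [h₂, neg, hM]; ring)
  have e₄ := log_increment_unique c₄ (h := fun t => M (0, t) + Real.pi * I) (by fun_prop)
    (fun t => by rw [h₄, neg, hM]; ring)
  rw [e₁, e₂, e₃, e₄]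
  ring

-- Reference logarithms against which increments along edges become integers. The index order fixes
-- the sign of the half turn between `φ u v` and `φ v u`; these signs supply the odd constant of the
-- parity count.
open Complex in
theorem exists_log_differences {x : Fin 5 → ℂ} (hx : Function.Injective x) :
    ∃ φ : Fin 5 → Fin 5 → ℂ, (∀ u v, u ≠ v → exp (φ u v) = x u - x v) ∧
      ∀ u v, u < v → φ u v = φ v u + Real.pi * I := by
  refine ⟨fun u v => if u < v then log (x v - x u) + Real.pi * I else log (x u - x v),
    fun u v huv => ?_, fun u v huv => ?_⟩
  · have h1 : x v - x u ≠ 0 := sub_ne_zero.2 fun h => huv (hx h).symm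
    have h2 : x u - x v ≠ 0 := sub_ne_zero.2 fun h => huv (hx h)
    dsimp only
    split_ifs
    · rw [exp_add, exp_pi_mul_I, exp_log h1]; ring
    · exact exp_log h2
  · simp [huv, huv.not_gt]

open Complex in
/-- There is no drawing of `K₅` in which nonadjacent edges are disjoint. -/
theorem not_exists_drawing_top_fin_five (x : Fin 5 → ℂ) (hx : Function.Injective x)
    (γ : Fin 5 → Fin 5 → ℝ → ℂ) (hc : ∀ a b, a < b → Continuous (γ a b))
    (h0 : ∀ a b, a < b → γ a b 0 = x a) (h1 : ∀ a b, a < b → γ a b 1 = x b)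
    (hv : ∀ a b v, a < b → v ≠ a → v ≠ b → ∀ t, γ a b t ≠ x v)
    (hd : ∀ a b c d, a < b → c < d → a ≠ c → a ≠ d → b ≠ c → b ≠ d →
      ∀ s t, γ a b s ≠ γ c d t) : False := by
  obtain ⟨φ, hφ, hs⟩ := exists_log_differences hx
  have hl : ∀ v a b, ∃ l : ℝ → ℂ, a < b → v ≠ a → v ≠ b →
      Continuous l ∧ ∀ t, exp (l t) = γ a b t - x v := by
    intro v a b
    by_cases h : a < b ∧ v ≠ a ∧ v ≠ b
    · obtain ⟨l, hl⟩ := exists_continuous_log (f := fun t => γ a b t - x v)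
        ((hc a b h.1).sub continuous_const) (fun t => sub_ne_zero.2 (hv a b v h.1 h.2.1 h.2.2 t))
      exact ⟨l, fun _ _ _ => hl⟩
    · exact ⟨0, fun h1 h2 h3 => (h ⟨h1, h2, h3⟩).elim⟩
  choose l hl using hl
  have hn : ∀ v a b, ∃ n : ℤ, a < b → v ≠ a → v ≠ b →
      l v a b 1 - l v a b 0 = φ b v - φ a v + n * (2 * Real.pi * I) := by
    intro v a b
    by_cases h : a < b ∧ v ≠ a ∧ v ≠ b
    · obtain ⟨hab, hva, hvb⟩ := h
      have hl' := (hl v a b hab hva hvb).2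
      obtain ⟨n, hn⟩ := exp_eq_exp_iff_exists_int.1
        ((hl' 1).trans ((congrArg (· - x v) (h1 a b hab)).trans (hφ b v hvb.symm).symm))
      obtain ⟨m, hm⟩ := exp_eq_exp_iff_exists_int.1
        ((hl' 0).trans ((congrArg (· - x v) (h0 a b hab)).trans (hφ a v hva.symm).symm))
      refine ⟨n - m, fun _ _ _ => ?_⟩
      rw [hn, hm]; push_cast; ring
    · exact ⟨0, fun h1 h2 h3 => (h ⟨h1, h2, h3⟩).elim⟩
  choose n hn using hn
  -- `σ` records the sign of that half turn, so that the reference terms also become integers.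
  let σ : Fin 5 → Fin 5 → ℤ := fun u v => if u < v then 1 else 0
  have hσ : ∀ u v, u ≠ v → φ u v - φ v u = (2 * σ u v - 1) * (Real.pi * I) := by
    intro u v huv
    rcases lt_or_gt_of_ne huv with h | h
    · simp only [σ, h, if_true, hs u v h]; push_cast; ring
    · simp only [σ, h.not_gt, if_false, hs v u h]; push_cast; ring
  have key : ∀ a b c d, a < b → c < d → a ≠ c → a ≠ d → b ≠ c → b ≠ d →
      n c a b + n b c d - n d a b - n a c d + σ b c + σ c a + σ d b + σ a d - 2 = 0 := by
    intro a b c d hab hcd hac had hbc hbd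
    have sq := log_increment_square (hc a b hab) (hc c d hcd) (hd a b c d hab hcd hac had hbc hbd)
      (hl c a b hab hac.symm hbc.symm).1 (hl b c d hcd hbc hbd).1
      (hl d a b hab had.symm hbd.symm).1 (hl a c d hcd hac had).1
      (by rw [h0 c d hcd]; exact (hl c a b hab hac.symm hbc.symm).2)
      (by rw [h1 a b hab]; exact (hl b c d hcd hbc hbd).2)
      (by rw [h1 c d hcd]; exact (hl d a b hab had.symm hbd.symm).2)
      (by rw [h0 a b hab]; exact (hl a c d hcd hac had).2)
    rw [hn c a b hab hac.symm hbc.symm, hn b c d hcd hbc hbd, hn d a b hab had.symm hbd.symm,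
      hn a c d hcd hac had] at sq
    have e : ((n c a b + n b c d - n d a b - n a c d + σ b c + σ c a + σ d b + σ a d - 2 : ℤ) : ℂ)
        * (2 * Real.pi * I) = 0 := by
      push_cast
      linear_combination sq - hσ b c hbc - hσ c a hac.symm - hσ d b hbd.symm - hσ a d had
    exact_mod_cast (mul_eq_zero.1 e).resolve_right two_pi_I_ne_zero
  have k1 := key 0 1 2 3 (by decide) (by decide) (by decide) (by decide) (by decide) (by decide)
  have k2 := key 0 2 1 3 (by decide) (by decide) (by decide) (by decide) (by decide) (by decide)
  have k3 := key 0 3 1 2 (by decide) (by decide) (by decide) (by decide) (by decide) (by decide)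
  have k4 := key 0 1 2 4 (by decide) (by decide) (by decide) (by decide) (by decide) (by decide)
  have k5 := key 0 2 1 4 (by decide) (by decide) (by decide) (by decide) (by decide) (by decide)
  have k6 := key 0 4 1 2 (by decide) (by decide) (by decide) (by decide) (by decide) (by decide)
  have k7 := key 0 1 3 4 (by decide) (by decide) (by decide) (by decide) (by decide) (by decide)
  have k8 := key 0 3 1 4 (by decide) (by decide) (by decide) (by decide) (by decide) (by decide)
  have k9 := key 0 4 1 3 (by decide) (by decide) (by decide) (by decide) (by decide) (by decide)
  have k10 := key 0 2 3 4 (by decide) (by decide) (by decide) (by decide) (by decide) (by decide)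
  have k11 := key 0 3 2 4 (by decide) (by decide) (by decide) (by decide) (by decide) (by decide)
  have k12 := key 0 4 2 3 (by decide) (by decide) (by decide) (by decide) (by decide) (by decide)
  have k13 := key 1 2 3 4 (by decide) (by decide) (by decide) (by decide) (by decide) (by decide)
  have k14 := key 1 3 2 4 (by decide) (by decide) (by decide) (by decide) (by decide) (by decide)
  have k15 := key 1 4 2 3 (by decide) (by decide) (by decide) (by decide) (by decide) (by decide)
  -- Sum mod 2: each `n v a b` occurs in two equations, one for each edge from `v` disjoint from
  -- `ab`. The `σ` terms are odd exactly for the interlaced pair in each of the five 4-subsets, so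
  -- the constant is odd.
  simp only [σ, Fin.reduceLT, if_true, if_false] at k1 k2 k3 k4 k5 k6 k7 k8 k9 k10 k11 k12 k13 k14 k15
  omega

/-! ### From planar embeddings to drawings with oriented edges -/

theorem PlanarEmbedding.exists_curve {V : Type*} {G : SimpleGraph V} (P : PlanarEmbedding G)
    {a b : V} (hab : G.Adj a b) : ∃ γ : C(unitInterval, ℂ), γ 0 = P.vertex a ∧ γ 1 = P.vertex b ∧
      Set.range γ = Set.range (P.edge ⟨s(a, b), hab⟩) := by
  have h := P.edge_ends ⟨s(a, b), hab⟩
  rw [Sym2.map_mk, Sym2.eq_iff] at h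
  rcases h with ⟨h0, h1⟩ | ⟨h0, h1⟩
  · exact ⟨_, h0, h1, rfl⟩
  · refine ⟨(P.edge ⟨s(a, b), hab⟩).comp ⟨unitInterval.symm, unitInterval.continuous_symm⟩,
      by simpa using h1, by simpa using h0, ?_⟩
    rw [ContinuousMap.coe_comp]
    exact unitInterval.symm_bijective.surjective.range_comp _

theorem PlanarEmbedding.mem_range_edge {V : Type*} {G : SimpleGraph V} (P : PlanarEmbedding G)
    {a b : V} (hab : G.Adj a b) {z : ℂ} (hz : z ∈ Set.range (P.edge ⟨s(a, b), hab⟩)) :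
    z = P.vertex a ∨ z = P.vertex b ∨
      ∃ t ∈ Set.Ioo (0 : unitInterval) 1, P.edge ⟨s(a, b), hab⟩ t = z := by
  obtain ⟨t, rfl⟩ := hz
  have h := P.edge_ends ⟨s(a, b), hab⟩
  rw [Sym2.map_mk, Sym2.eq_iff] at h
  rcases eq_or_ne t 0 with rfl | h0
  · rcases h with h | h
    · exact .inl h.1
    · exact .inr (.inl h.1)
  rcases eq_or_ne t 1 with rfl | h1
  · rcases h with h | h
    · exact .inr (.inl h.2)
    · exact .inl h.2
  exact .inr (.inr ⟨t, ⟨unitInterval.pos_iff_ne_zero.2 h0, unitInterval.lt_one_iff_ne_one.2 h1⟩,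
    rfl⟩)

theorem PlanarEmbedding.vertex_notMem_range_edge {V : Type*} {G : SimpleGraph V}
    (P : PlanarEmbedding G) {a b v : V} (hab : G.Adj a b) (ha : v ≠ a) (hb : v ≠ b) :
    P.vertex v ∉ Set.range (P.edge ⟨s(a, b), hab⟩) := by
  intro h
  rcases P.mem_range_edge hab h with h | h | ⟨t, ht, h⟩
  · exact ha (P.vertex_injective h)
  · exact hb (P.vertex_injective h)
  · exact P.edge_ne_vertex _ t ht v h

theorem PlanarEmbedding.disjoint_range_edge {V : Type*} {G : SimpleGraph V}
    (P : PlanarEmbedding G) {a b c d : V} (hab : G.Adj a b) (hcd : G.Adj c d)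
    (hac : a ≠ c) (had : a ≠ d) (hbc : b ≠ c) (hbd : b ≠ d) :
    Disjoint (Set.range (P.edge ⟨s(a, b), hab⟩)) (Set.range (P.edge ⟨s(c, d), hcd⟩)) := by
  rw [Set.disjoint_left]
  intro z h h'
  rcases P.mem_range_edge hab h with rfl | rfl | ⟨t, ht, e⟩
  · exact P.vertex_notMem_range_edge hcd hac had h'
  · exact P.vertex_notMem_range_edge hcd hbc hbd h'
  rcases P.mem_range_edge hcd h' with rfl | rfl | ⟨t', ht', e'⟩
  · exact P.vertex_notMem_range_edge hab hac.symm hbc.symm h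
  · exact P.vertex_notMem_range_edge hab had.symm hbd.symm h
  refine P.edge_ne_edge _ _ ?_ t ht t' ht' (e.trans e'.symm)
  intro h
  rcases Sym2.eq_iff.1 (congrArg Subtype.val h) with h | h
  · exact hac h.1
  · exact had h.1

theorem not_isPlanar_top_fin_five : ¬ IsPlanar (⊤ : SimpleGraph (Fin 5)) := by
  rintro ⟨P⟩
  have adj : ∀ a b : Fin 5, a < b → (⊤ : SimpleGraph (Fin 5)).Adj a b := fun a b h => h.ne
  have hγ : ∀ a b : Fin 5, ∃ γ : C(unitInterval, ℂ), ∀ h : a < b,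
      γ 0 = P.vertex a ∧ γ 1 = P.vertex b ∧
        Set.range γ = Set.range (P.edge ⟨s(a, b), adj a b h⟩) := by
    intro a b
    by_cases h : a < b
    · obtain ⟨γ, hγ⟩ := P.exists_curve (adj a b h)
      exact ⟨γ, fun _ => hγ⟩
    · exact ⟨0, fun h' => (h h').elim⟩
  choose γ hγ using hγ
  -- Constant extension beyond `[0, 1]` keeps the range of each curve, so disjointness persists for
  -- all real parameters.
  refine not_exists_drawing_top_fin_five P.vertex P.vertex_injective
    (fun a b => Set.IccExtend zero_le_one (γ a b)) (fun a b _ => (γ a b).continuous.Icc_extend')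
    (fun a b h => ?_) (fun a b h => ?_) (fun a b v h ha hb t e => ?_)
    (fun a b c d hab hcd hac had hbc hbd s t e => ?_)
  · rw [Set.IccExtend_left]; exact (hγ a b h).1
  · rw [Set.IccExtend_right]; exact (hγ a b h).2.1
  · refine P.vertex_notMem_range_edge (adj a b h) ha hb ?_
    rw [← (hγ a b h).2.2, ← e]
    exact Set.mem_range_self _
  · have h := P.disjoint_range_edge (adj a b hab) (adj c d hcd) hac had hbc hbd
    rw [← (hγ a b hab).2.2, ← (hγ c d hcd).2.2] at h
    refine Set.disjoint_left.1 h (Set.mem_range_self (Set.projIcc 0 1 zero_le_one s)) ?_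
    exact ⟨Set.projIcc 0 1 zero_le_one t, e.symm⟩

/-! ### Radial segments and concentric arcs -/

theorem mem_segment_ofReal_mul {a b : ℝ} {c z : ℂ} :
    z ∈ segment ℝ ((a : ℂ) * c) (b * c) ↔ ∃ t ∈ segment ℝ a b, (t : ℂ) * c = z := by
  have h := image_segment ℝ (LinearMap.toSpanSingleton ℝ ℂ c).toAffineMap a b
  simp only [LinearMap.coe_toAffineMap, LinearMap.toSpanSingleton_apply, Complex.real_smul] at h
  rw [← h]
  simp

theorem neg_ofReal_mul_exp_add_pi (r θ : ℝ) :
    (r : ℂ) * Complex.exp ((θ + Real.pi : ℝ) * Complex.I) =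
      (-r : ℝ) * Complex.exp (θ * Complex.I) := by
  push_cast
  rw [add_mul, Complex.exp_add, Complex.exp_pi_mul_I]
  ring

theorem CircArc.polar_mem_points (a : CircArc) {θ : ℝ} (h₁ : a.negArg ≤ θ) (h₂ : θ ≤ a.posArg) :
    (a.radius : ℂ) * Complex.exp (θ * Complex.I) ∈ a.points :=
  ⟨θ, ⟨h₁, h₂⟩, rfl⟩

theorem CircArc.of_polar_mem_points {a : CircArc} {t φ : ℝ} (ht : 0 < t)
    (h : (t : ℂ) * Complex.exp (φ * Complex.I) ∈ a.points) :
    t = a.radius ∧ ∃ k : ℤ, φ + k * (2 * Real.pi) ∈ Set.Icc a.negArg a.posArg := by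
  obtain ⟨θ, hθ, e⟩ := h
  dsimp only at e
  have hr : t = a.radius := by
    have := congrArg norm e
    rw [norm_mul, norm_mul, Complex.norm_exp_ofReal_mul_I, Complex.norm_exp_ofReal_mul_I,
      Complex.norm_of_nonneg ht.le, Complex.norm_of_nonneg a.radius_pos.le] at this
    linarith
  refine ⟨hr, ?_⟩
  rw [hr] at e
  obtain ⟨k, hk⟩ := Complex.exp_eq_exp_iff_exists_int.1
    (mul_left_cancel₀ (Complex.ofReal_ne_zero.2 a.radius_pos.ne') e)
  refine ⟨k, ?_⟩
  have : θ = φ + k * (2 * Real.pi) := by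
    have := congrArg Complex.im hk
    simpa using this
  rwa [← this]

theorem collinear_zero_real_mul (a b : ℝ) (c : ℂ) :
    Collinear ℝ {0, (a : ℂ) * c, (b : ℂ) * c} := by
  rw [collinear_iff_of_mem (p₀ := 0) (by simp)]
  refine ⟨c, ?_⟩
  rintro p (rfl | rfl | rfl)
  · exact ⟨0, by simp⟩
  · exact ⟨a, by simp⟩
  · exact ⟨b, by simp⟩

theorem exists_eq_add_int_mul_pi_of_collinear {a b θ ψ : ℝ} (ha : 0 < a) (hb : 0 < b)
    (h : Collinear ℝ {0, (a : ℂ) * Complex.exp (θ * Complex.I),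
      (b : ℂ) * Complex.exp (ψ * Complex.I)}) :
    ∃ k : ℤ, ψ = θ + k * Real.pi := by
  rw [collinear_iff_of_mem (p₀ := 0) (by simp)] at h
  obtain ⟨d, hd⟩ := h
  obtain ⟨s, hs⟩ := hd ((a : ℂ) * Complex.exp (θ * Complex.I)) (by simp)
  obtain ⟨t, ht⟩ := hd ((b : ℂ) * Complex.exp (ψ * Complex.I)) (by simp)
  simp only [vadd_eq_add, add_zero, Complex.real_smul] at hs ht
  have h1 := congrArg Complex.re hs
  have h2 := congrArg Complex.im hs
  have h3 := congrArg Complex.re ht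
  have h4 := congrArg Complex.im ht
  simp only [Complex.re_ofReal_mul, Complex.im_ofReal_mul, Complex.exp_ofReal_mul_I_re,
    Complex.exp_ofReal_mul_I_im] at h1 h2 h3 h4
  -- The cross product of two multiples of `d` vanishes.
  have h5 : a * b * Real.sin (ψ - θ) = 0 := by
    rw [Real.sin_sub]
    linear_combination (a * Real.cos θ) * h4 - (a * Real.sin θ) * h3 + t * d.im * h1 - t * d.re * h2
  obtain ⟨k, hk⟩ := Real.sin_eq_zero_iff.1
    ((mul_eq_zero.1 h5).resolve_left (mul_pos ha hb).ne')
  exact ⟨k, by linarith⟩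

/-- Two arcs see each other along a ray if no other arc meets the ray between them. -/
theorem sees_zero_of_ray {V : Type*} {A : V → CircArc} {u v : V} {θ : ℝ}
    (hu : θ ∈ Set.Icc (A u).negArg (A u).posArg) (hv : θ ∈ Set.Icc (A v).negArg (A v).posArg)
    (hr : (A u).radius ≤ (A v).radius)
    (h : ∀ w, w ≠ u → w ≠ v → (A u).radius ≤ (A w).radius → (A w).radius ≤ (A v).radius →
      ∀ k : ℤ, θ + k * (2 * Real.pi) ∉ Set.Icc (A w).negArg (A w).posArg) :
    Sees 0 A u v := by
  refine ⟨_, (A u).polar_mem_points hu.1 hu.2, _, (A v).polar_mem_points hv.1 hv.2,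
    collinear_zero_real_mul _ _ _, ?_⟩
  rw [Nat.cast_zero, nonpos_iff_eq_zero, Set.encard_eq_zero, Set.eq_empty_iff_forall_notMem]
  rintro w ⟨hwu, hwv, z, hz, hz'⟩
  obtain ⟨t, ht, rfl⟩ := mem_segment_ofReal_mul.1 hz'
  rw [segment_eq_Icc hr] at ht
  obtain ⟨rfl, k, hk⟩ := CircArc.of_polar_mem_points ((A u).radius_pos.trans_le ht.1) hz
  exact h w hwu hwv ht.1 ht.2 k hk

/-- Two arcs see each other through the centre if no other arc meets one of the two radii. -/
theorem sees_zero_of_opposite {V : Type*} {A : V → CircArc} {u v : V} {θ : ℝ}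
    (hu : θ ∈ Set.Icc (A u).negArg (A u).posArg)
    (hv : θ + Real.pi ∈ Set.Icc (A v).negArg (A v).posArg)
    (h : ∀ w, w ≠ u → w ≠ v → (A w).radius ≤ (A u).radius →
      ∀ k : ℤ, θ + k * (2 * Real.pi) ∉ Set.Icc (A w).negArg (A w).posArg)
    (h' : ∀ w, w ≠ u → w ≠ v → (A w).radius ≤ (A v).radius →
      ∀ k : ℤ, θ + Real.pi + k * (2 * Real.pi) ∉ Set.Icc (A w).negArg (A w).posArg) :
    Sees 0 A u v := by
  refine ⟨_, (A u).polar_mem_points hu.1 hu.2, _, (A v).polar_mem_points hv.1 hv.2, ?_⟩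
  rw [neg_ofReal_mul_exp_add_pi]
  refine ⟨collinear_zero_real_mul _ _ _, ?_⟩
  rw [Nat.cast_zero, nonpos_iff_eq_zero, Set.encard_eq_zero, Set.eq_empty_iff_forall_notMem]
  rintro w ⟨hwu, hwv, z, hz, hz'⟩
  obtain ⟨t, ht, rfl⟩ := mem_segment_ofReal_mul.1 hz'
  rw [segment_symm, segment_eq_Icc (by linarith [(A u).radius_pos, (A v).radius_pos])] at ht
  -- The signed coordinate `t` is negative on the ray opposite to `θ`, positive on the ray `θ`, and
  -- zero at the centre, which lies on no arc.
  rcases lt_trichotomy t 0 with h0 | rfl | h0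
  · have e := neg_ofReal_mul_exp_add_pi (-t) θ
    rw [neg_neg] at e
    rw [← e] at hz
    obtain ⟨ht', k, hk⟩ := CircArc.of_polar_mem_points (neg_pos.2 h0) hz
    exact h' w hwu hwv (by linarith [ht.1]) k hk
  · obtain ⟨φ, -, e⟩ := hz
    have e' := congrArg norm e
    rw [norm_mul, Complex.norm_exp_ofReal_mul_I,
      Complex.norm_of_nonneg (A w).radius_pos.le] at e'
    simp only [Complex.ofReal_zero, zero_mul, norm_zero, mul_one] at e'
    exact (A w).radius_pos.ne' e'
  · obtain ⟨rfl, k, hk⟩ := CircArc.of_polar_mem_points h0 hz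
    exact h w hwu hwv ht.2 k hk

/-! ### `K₅` is an arc visibility graph -/

/-- Concentric arcs of radii `1, …, 5` whose end arguments are multiples of `π / 3`. -/
noncomputable def hexArc (s e : Fin 5 → ℤ) (h : ∀ i, s i < e i ∧ e i < s i + 6) (i : Fin 5) :
    CircArc where
  radius := (i : ℕ) + 1
  negArg := s i * (Real.pi / 3)
  posArg := e i * (Real.pi / 3)
  radius_pos := by positivity
  neg_lt_pos := mul_lt_mul_of_pos_right (by exact_mod_cast (h i).1) (by positivity)
  pos_lt := by
    have : (e i : ℝ) < s i + 6 := by exact_mod_cast (h i).2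
    nlinarith [Real.pi_pos]

section
variable {s e : Fin 5 → ℤ} (h : ∀ i, s i < e i ∧ e i < s i + 6)

theorem mem_Icc_hexArc {m : ℤ} {i : Fin 5} :
    (m * (Real.pi / 3) : ℝ) ∈ Set.Icc (hexArc s e h i).negArg (hexArc s e h i).posArg ↔
      s i ≤ m ∧ m ≤ e i := by
  have hp : 0 < Real.pi / 3 := by positivity
  simp [hexArc, Set.mem_Icc, mul_le_mul_iff_left₀ hp]

theorem hexArc_radius_le {i j : Fin 5} :
    (hexArc s e h i).radius ≤ (hexArc s e h j).radius ↔ i ≤ j := by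
  simp [hexArc]

theorem disjoint_hexArc {i j : Fin 5} (hij : i ≠ j) :
    Disjoint (hexArc s e h i).points (hexArc s e h j).points := by
  rw [Set.disjoint_left]
  rintro z ⟨θ, hθ, rfl⟩ hz
  have := (CircArc.of_polar_mem_points (hexArc s e h i).radius_pos hz).1
  exact hij (le_antisymm ((hexArc_radius_le h).1 this.le) ((hexArc_radius_le h).1 this.ge))

theorem sees_hexArc_of_ray {u v : Fin 5} (m : ℤ) (hu : s u ≤ m ∧ m ≤ e u)
    (hv : s v ≤ m ∧ m ≤ e v) (hr : u ≤ v)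
    (hw : ∀ w, w ≠ u → w ≠ v → u ≤ w → w ≤ v → ∀ k : ℤ, ¬ (s w ≤ m + 6 * k ∧ m + 6 * k ≤ e w)) :
    Sees 0 (hexArc s e h) u v := by
  refine sees_zero_of_ray ((mem_Icc_hexArc h).2 hu) ((mem_Icc_hexArc h).2 hv)
    ((hexArc_radius_le h).2 hr) fun w h1 h2 h3 h4 k hk => ?_
  refine hw w h1 h2 ((hexArc_radius_le h).1 h3) ((hexArc_radius_le h).1 h4) k
    ((mem_Icc_hexArc h).1 ?_)
  convert hk using 1
  push_cast
  ring

theorem sees_hexArc_of_opposite {u v : Fin 5} (m : ℤ) (hu : s u ≤ m ∧ m ≤ e u)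
    (hv : s v ≤ m + 3 ∧ m + 3 ≤ e v)
    (hw : ∀ w, w ≠ u → w ≠ v → w ≤ u → ∀ k : ℤ, ¬ (s w ≤ m + 6 * k ∧ m + 6 * k ≤ e w))
    (hw' : ∀ w, w ≠ u → w ≠ v → w ≤ v →
      ∀ k : ℤ, ¬ (s w ≤ m + 3 + 6 * k ∧ m + 3 + 6 * k ≤ e w)) :
    Sees 0 (hexArc s e h) u v := by
  refine sees_zero_of_opposite ((mem_Icc_hexArc h).2 hu) ?_ (fun w h1 h2 h3 k hk => ?_)
    (fun w h1 h2 h3 k hk => ?_)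
  · convert (mem_Icc_hexArc h).2 hv using 1
    push_cast
    ring
  · refine hw w h1 h2 ((hexArc_radius_le h).1 h3) k ((mem_Icc_hexArc h).1 ?_)
    convert hk using 1
    push_cast
    ring
  · refine hw' w h1 h2 ((hexArc_radius_le h).1 h3) k ((mem_Icc_hexArc h).1 ?_)
    convert hk using 1
    push_cast
    ring

end

theorem isArcVisibilityGraph_top_fin_five :
    IsArcVisibilityGraph 0 (⊤ : SimpleGraph (Fin 5)) := by
  -- In units of `π / 3` the arcs, from the inside out, are `[0,1]`, `[1,2]`, `[0,1]`, `[1,3]`,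
  -- `[0,5]`. Seven pairs see each other along a ray; `03`, `04` and `14` do so through the centre.
  have h : ∀ i, (![0, 1, 0, 1, 0] : Fin 5 → ℤ) i < (![1, 2, 1, 3, 5] : Fin 5 → ℤ) i ∧
      (![1, 2, 1, 3, 5] : Fin 5 → ℤ) i < (![0, 1, 0, 1, 0] : Fin 5 → ℤ) i + 6 := by decide
  have ray : ∀ u v : Fin 5, ∀ m : ℤ, _ := fun u v m => sees_hexArc_of_ray h (u := u) (v := v) m
  have opp : ∀ u v : Fin 5, ∀ m : ℤ, _ := fun u v m =>
    sees_hexArc_of_opposite h (u := u) (v := v) m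
  have h01 := ray 0 1 1 (by decide) (by decide) (by decide) 
    (by intro w; fin_cases w <;> simp)
  have h02 := ray 0 2 0 (by decide) (by decide) (by decide) 
    (by intro w; fin_cases w <;> simp <;> omega)
  have h03 := opp 0 3 0 (by decide) (by decide) (by intro w; fin_cases w <;> simp)
    (by intro w; fin_cases w <;> simp <;> omega)
  have h04 := opp 0 4 1 (by decide) (by decide) (by intro w; fin_cases w <;> simp)
    (by intro w; fin_cases w <;> simp <;> omega)
  have h12 := ray 1 2 1 (by decide) (by decide) (by decide) 
    (by intro w; fin_cases w <;> simp)
  have h13 := ray 1 3 2 (by decide) (by decide) (by decide) 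
    (by intro w; fin_cases w <;> simp <;> omega)
  have h14 := opp 1 4 2 (by decide) (by decide) (by intro w; fin_cases w <;> simp <;> omega)
    (by intro w; fin_cases w <;> simp <;> omega)
  have h23 := ray 2 3 1 (by decide) (by decide) (by decide) 
    (by intro w; fin_cases w <;> simp)
  have h24 := ray 2 4 0 (by decide) (by decide) (by decide) 
    (by intro w; fin_cases w <;> simp <;> omega)
  have h34 := ray 3 4 1 (by decide) (by decide) (by decide) 
    (by intro w; fin_cases w <;> simp)
  have key : ∀ u v : Fin 5, u < v → Sees 0 (hexArc _ _ h) u v := by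
    intro u v huv
    fin_cases u <;> fin_cases v <;> first | exact absurd huv (by decide) | assumption
  refine ⟨hexArc _ _ h, fun i j hij => disjoint_hexArc h hij, ?_⟩
  ext u v
  simp only [SimpleGraph.top_adj, arcVisibilityGraph]
  refine ⟨fun huv => ⟨huv, ?_⟩, fun huv => huv.1⟩
  rcases lt_or_gt_of_ne huv with h' | h'
  · exact key u v h'
  · exact (key v u h').symm

/-! ### Semi-arc visibility graphs are planar -/

/-- Cylindrical coordinates on the punctured plane: `(x, y) ↦ exp (x + i y)`. -/
noncomputable def cylinder (x y : ℝ) : ℂ := Complex.exp (x + y * Complex.I)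

theorem continuous_cylinder : Continuous fun p : ℝ × ℝ => cylinder p.1 p.2 := by
  unfold cylinder
  fun_prop

theorem cylinder_two_pi (x : ℝ) : cylinder x (2 * Real.pi) = cylinder x 0 := by
  simp [cylinder, Complex.exp_add]

theorem fst_eq_of_cylinder_eq {x y x' y' : ℝ} (h : cylinder x y = cylinder x' y') : x = x' := by
  have h' := congrArg norm h
  simpa [cylinder, Complex.norm_exp] using h'

theorem snd_eq_of_cylinder_eq {x y x' y' : ℝ} (h : cylinder x y = cylinder x' y')
    (hy : 0 ≤ y) (hy' : 0 ≤ y') (hy2 : y < 2 * Real.pi) (hy2' : y' < 2 * Real.pi) : y = y' := by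
  obtain ⟨n, hn⟩ := Complex.exp_eq_exp_iff_exists_int.1 h
  have e : y = y' + n * (2 * Real.pi) := by simpa using congrArg Complex.im hn
  have h1 : (n : ℝ) < 1 := by nlinarith [Real.pi_pos]
  have h2 : (-1 : ℝ) < n := by nlinarith [Real.pi_pos]
  have h3 : n = 0 := by
    have h1 : n < 1 := by exact_mod_cast h1
    have h2 : -1 < n := by exact_mod_cast h2
    omega
  simp [e, h3]

/-- Second coordinate of the curve used for an edge from `a` to `b`: a flat parabola if `D`,
a straight descent around the whole cylinder otherwise. -/
noncomputable def edgeHeight (D : Prop) (a b t : ℝ) : ℝ :=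
  open Classical in
  if D then t * (1 - t) * (b - a) ^ 2 else 2 * Real.pi * (1 - t)

theorem continuous_edgeHeight (D : Prop) (a b : ℝ) : Continuous (edgeHeight D a b) := by
  unfold edgeHeight
  split_ifs <;> fun_prop

theorem edgeHeight_mem_Ioo {D : Prop} {a b t : ℝ} (ha : 0 < a) (hb : b < 1) (hab : a < b)
    (ht0 : 0 < t) (ht1 : t < 1) : edgeHeight D a b t ∈ Set.Ioo 0 (2 * Real.pi) := by
  have hp := Real.pi_gt_three
  have h1 : 0 < 1 - t := by linarith
  have h2 : 0 < b - a := by linarith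
  unfold edgeHeight
  split_ifs
  · refine ⟨by positivity, ?_⟩
    have h3 : t * (1 - t) < 1 := by nlinarith
    have h4 : (b - a) ^ 2 < 1 := by nlinarith
    have h5 : t * (1 - t) * (b - a) ^ 2 < 1 := by
      have : 0 < t * (1 - t) := by positivity
      nlinarith
    linarith
  · exact ⟨by positivity, by nlinarith⟩

/-- Two curves with heights `edgeHeight`, over intervals in noncrossing position, are disjoint. -/
theorem eq_of_edgeHeight_eq {D D' : Prop} {a b c d s t : ℝ}
    (ha : 0 < a) (hb : b < 1) (hab : a < b) (hc : 0 < c) (hd : d < 1) (hcd : c < d)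
    (hs0 : 0 < s) (hs1 : s < 1) (ht0 : 0 < t) (ht1 : t < 1)
    (hDD : D → D' → ¬ (a < c ∧ c < b ∧ b < d) ∧ ¬ (c < a ∧ a < d ∧ d < b))
    (hDT : D → ¬ D' → ¬ (a < d ∧ d < b)) (hTD : ¬ D → D' → ¬ (c < b ∧ b < d))
    (hTT : ¬ D → ¬ D' → ¬ (a < c ∧ d < b) ∧ ¬ (c < a ∧ b < d))
    (hx : a + s * (b - a) = c + t * (d - c)) (hy : edgeHeight D a b s = edgeHeight D' c d t) :
    a = c ∧ b = d := by
  have hp := Real.pi_gt_three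
  -- a parabola over `(a, b)` never meets a descent ending at `d`
  have mixed : ∀ {a b c d s t : ℝ}, 0 < a → b < 1 → a < b → 0 < c → d < 1 → c < d →
      0 < s → s < 1 → 0 < t → t < 1 → ¬ (a < d ∧ d < b) → a + s * (b - a) = c + t * (d - c) →
      s * (1 - s) * (b - a) ^ 2 = 2 * Real.pi * (1 - t) → False := by
    intro a b c d s t ha hb hab hc hd hcd hs0 hs1 ht0 ht1 hn hx hy
    have e1 : 0 < s * (b - a) := mul_pos hs0 (by linarith)
    have e2 : 0 < (1 - t) * (d - c) := mul_pos (by linarith) (by linarith)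
    have hbd : b ≤ d := by
      by_contra! h
      exact hn ⟨by nlinarith, h⟩
    have e3 : (1 - s) * (b - a) ≤ (1 - t) * (d - c) := by nlinarith
    have e4 : s * (b - a) < 1 := by nlinarith
    -- The descent has height `2π(1 - t)`, while at the same abscissa the parabola is at most `(1 -
    -- t)(d - c) < 1 - t`.
    have e5 : (1 - t) * (d - c) < 1 - t := by nlinarith
    have e6 : s * (1 - s) * (b - a) ^ 2 = (s * (b - a)) * ((1 - s) * (b - a)) := by ring
    have e7 : (s * (b - a)) * ((1 - s) * (b - a)) ≤ 1 * ((1 - t) * (d - c)) :=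
      mul_le_mul e4.le e3 (mul_nonneg (by linarith) (by linarith)) zero_le_one
    nlinarith
  -- strictly nested parabolas are disjoint
  have nested : ∀ {a b c d s t : ℝ}, 0 < s → s < 1 → a < b → c < d → 0 < t → t < 1 →
      a < c → ¬ (a < c ∧ c < b ∧ b < d) → a + s * (b - a) = c + t * (d - c) →
      s * (1 - s) * (b - a) ^ 2 = t * (1 - t) * (d - c) ^ 2 → False := by
    intro a b c d s t hs0 hs1 hab hcd ht0 ht1 hac hn hx hy
    have e1 : 0 < t * (d - c) := mul_pos ht0 (by linarith)
    have e2 : 0 < (1 - s) * (b - a) := mul_pos (by linarith) (by linarith)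
    have hdb : d ≤ b := by
      by_contra! h
      exact hn ⟨hac, by nlinarith, h⟩
    have e3 : t * (d - c) < s * (b - a) := by linarith
    have e4 : (1 - t) * (d - c) ≤ (1 - s) * (b - a) := by nlinarith
    have e5 : (t * (d - c)) * ((1 - t) * (d - c)) < (s * (b - a)) * ((1 - s) * (b - a)) :=
      mul_lt_mul e3 e4 (mul_pos (by linarith) (by linarith)) (by linarith)
    nlinarith
  by_cases hD : D <;> by_cases hD' : D' <;> simp only [edgeHeight, hD, hD', if_true, if_false] at hy
  · rcases lt_trichotomy a c with h | h | h
    · exact (nested hs0 hs1 hab hcd ht0 ht1 h (hDD hD hD').1 hx hy).elim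
    · refine ⟨h, ?_⟩
      subst h
      have e1 : s * (b - a) = t * (d - a) := by linarith
      have e2 : 0 < s * (b - a) := mul_pos hs0 (by linarith)
      -- With `X` the common value in `e1`, the heights are `X * (b - a - X)` and `X * (d - a - X)`.
      have e3 : (s * (b - a)) * (b - d) = 0 := by
        linear_combination hy + (b - a + t * (d - a) - (d - a) + s * (b - a) - (b - a) + (d - a)) * e1 - (b - a) * e1 + (b - d) * e1
      linarith [(mul_eq_zero.1 e3).resolve_left e2.ne']
    · exact (nested ht0 ht1 hcd hab hs0 hs1 h (hDD hD hD').2 hx.symm hy.symm).elim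
  · exact (mixed ha hb hab hc hd hcd hs0 hs1 ht0 ht1 (hDT hD hD') hx hy).elim
  · exact (mixed hc hd hcd ha hb hab ht0 ht1 hs0 hs1 (hTD hD hD') hx.symm hy.symm).elim
  · have hst : s = t := by nlinarith
    subst hst
    obtain ⟨h1, h2⟩ := hTT hD hD'
    have e : (1 - s) * (a - c) = s * (d - b) := by linarith
    rcases lt_trichotomy a c with h | h | h
    · exact (h1 ⟨h, by nlinarith⟩).elim
    · refine ⟨h, ?_⟩
      rw [h, sub_self, mul_zero] at e
      linarith [(mul_eq_zero.1 e.symm).resolve_left hs0.ne']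
    · exact (h2 ⟨h, by nlinarith⟩).elim

/-- A graph with vertices on a generatrix of a cylinder is planar if its edges are of two kinds:
arcs `D` on one side of the generatrix that do not cross each other, and curves `T` around the
cylinder whose ends are monotone and whose upper ends are not below an arc `D`. -/
theorem isPlanar_of_cylindrical {V : Type*} (G : SimpleGraph V) (x : V → ℝ)
    (hx : Function.Injective x) (hx0 : ∀ v, 0 < x v) (hx1 : ∀ v, x v < 1) (D T : V → V → Prop)
    (hG : ∀ a b, G.Adj a b → x a < x b → D a b ∨ T a b)
    (hDD : ∀ a b c d, D a b → D c d → ¬ (x a < x c ∧ x c < x b ∧ x b < x d))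
    (hDT : ∀ a b c d, D a b → T c d → ¬ (x a < x d ∧ x d < x b))
    (hTT : ∀ a b c d, T a b → T c d → ¬ (x a < x c ∧ x d < x b)) : IsPlanar G := by
  have hE : ∀ e : G.edgeSet, ∃ a b, (e : Sym2 V) = s(a, b) ∧ x a < x b ∧ (D a b ∨ T a b) := by
    rintro ⟨e, he⟩
    induction e using Sym2.ind with | _ a b => ?_
    rcases lt_or_gt_of_ne (hx.ne (G.ne_of_adj he)) with h | h
    · exact ⟨a, b, rfl, h, hG a b he h⟩
    · exact ⟨b, a, Sym2.eq_swap, h, hG b a (show G.Adj a b from he).symm h⟩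
  choose a b hab hlt hDT' using hE
  refine ⟨{
    vertex := fun v => cylinder (x v) 0
    edge := fun e => ⟨fun t => cylinder (x (a e) + t * (x (b e) - x (a e)))
      (edgeHeight (D (a e) (b e)) (x (a e)) (x (b e)) t), ?_⟩
    vertex_injective := fun u v h => hx (fst_eq_of_cylinder_eq h)
    edge_injective := ?_
    edge_ends := ?_
    edge_ne_vertex := ?_
    edge_ne_edge := ?_ }⟩
  · have := continuous_edgeHeight (D (a e) (b e)) (x (a e)) (x (b e))
    exact continuous_cylinder.comp (by fun_prop : Continuous fun t : unitInterval =>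
      ((x (a e) + t * (x (b e) - x (a e)) : ℝ),
        edgeHeight (D (a e) (b e)) (x (a e)) (x (b e)) t))
  · intro e s t h
    have h' := fst_eq_of_cylinder_eq h
    exact Subtype.ext (mul_right_cancel₀ (sub_pos.2 (hlt e)).ne' (add_left_cancel h'))
  · intro e
    rw [hab e, Sym2.map_mk, Sym2.eq_iff]
    left
    constructor
    · by_cases h : D (a e) (b e)
      · simp [edgeHeight, h]
      -- A descent starts at height `2π`, which is the generatrix again.
      · simp [edgeHeight, h, cylinder_two_pi]
    · simp [edgeHeight]
  · intro e t ht v h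
    have hy := edgeHeight_mem_Ioo (D := D (a e) (b e)) (hx0 (a e)) (hx1 (b e)) (hlt e) ht.1 ht.2
    exact hy.1.ne' (snd_eq_of_cylinder_eq h hy.1.le le_rfl hy.2 (by positivity))
  · intro e e' hne s hs t ht h
    have hy := edgeHeight_mem_Ioo (D := D (a e) (b e)) (hx0 (a e)) (hx1 (b e)) (hlt e) hs.1 hs.2
    have hy' := edgeHeight_mem_Ioo (D := D (a e') (b e')) (hx0 (a e')) (hx1 (b e')) (hlt e')
      ht.1 ht.2
    have hT : ∀ e, ¬ D (a e) (b e) → T (a e) (b e) := fun e h => (hDT' e).resolve_left h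
    obtain ⟨h1, h2⟩ := eq_of_edgeHeight_eq (hx0 _) (hx1 _) (hlt e) (hx0 _) (hx1 _) (hlt e')
      hs.1 hs.2 ht.1 ht.2
      (fun hD hD' => ⟨hDD _ _ _ _ hD hD', hDD _ _ _ _ hD' hD⟩)
      (fun hD hD' => hDT _ _ _ _ hD (hT _ hD')) (fun hD hD' => hDT _ _ _ _ hD' (hT _ hD))
      (fun hD hD' => ⟨hTT _ _ _ _ (hT _ hD) (hT _ hD'), hTT _ _ _ _ (hT _ hD') (hT _ hD)⟩)
      (fst_eq_of_cylinder_eq h) (snd_eq_of_cylinder_eq h hy.1.le hy'.1.le hy.2 hy'.2)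
    exact hne (Subtype.ext (by rw [hab e, hab e', hx h1, hx h2]))

/-! ### Sight lines between semi-arcs -/

section
variable {V : Type*} {A : V → CircArc} {α : ℝ}

/-- Arcs of equal radius would share their initial point. -/
theorem radius_injective_of_semiArc (hA : ∀ u v, u ≠ v → Disjoint (A u).points (A v).points)
    (hα : ∀ v, (A v).negArg = α) : Function.Injective fun v => (A v).radius := by
  intro u v h
  by_contra huv
  dsimp only at h
  have hu := (A u).polar_mem_points le_rfl (A u).neg_lt_pos.le
  have hv := (A v).polar_mem_points le_rfl (A v).neg_lt_pos.le
  rw [hα] at hu hv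
  rw [h] at hu
  exact Set.disjoint_left.1 (hA u v huv) hu hv

/-- The arc `u` sees the larger arc `v` along a ray. -/
def DirectSight (A : V → CircArc) (u v : V) : Prop :=
  ∀ w, (A u).radius < (A w).radius → (A w).radius < (A v).radius →
    (A w).posArg < (A u).posArg ∧ (A w).posArg < (A v).posArg

/-- The arc `u`, met by the ray of argument `θ`, sees the larger arc `v` through the centre,
without meeting `u` again on the other side. -/
def CentralSight (A : V → CircArc) (u v : V) : Prop :=
  ∃ θ, θ ≤ (A u).posArg ∧ θ + Real.pi ≤ (A v).posArg ∧
    (∀ w, (A w).radius < (A u).radius → (A w).posArg < θ) ∧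
    ∀ w, (A w).radius < (A v).radius → (A w).posArg < θ + Real.pi

/-- An arc that does not block a ray ends before it. So a sight through the centre is replaceable by
a direct one whenever both arcs reach the larger of the two arguments when `v` is there, or always
when `u` is there. -/
theorem directSight_or_centralSight (hα : ∀ v, (A v).negArg = α) {u v : V}
    (hr : (A u).radius < (A v).radius) (h : Sees 0 A u v) :
    DirectSight A u v ∨ CentralSight A u v := by
  obtain ⟨_, ⟨θ, hθ, rfl⟩, _, ⟨ψ, hψ, rfl⟩, hc, hk⟩ := h
  dsimp only at hc hk
  rw [Nat.cast_zero, nonpos_iff_eq_zero, Set.encard_eq_zero,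
    Set.eq_empty_iff_forall_notMem] at hk
  obtain ⟨k, rfl⟩ := exists_eq_add_int_mul_pi_of_collinear (A u).radius_pos (A v).radius_pos hc
  have hu := (A u).pos_lt
  have hv := (A v).pos_lt
  rw [hα, Set.mem_Icc] at hθ hψ
  rw [hα] at hu hv
  have hp := Real.pi_pos
  -- Both arguments lie in `[α, α + 2π)`, so they differ by `0`, `π` or `-π`.
  have k1 : (k : ℝ) < 2 := by nlinarith
  have k2 : (-2 : ℝ) < k := by nlinarith
  have k1' : k < 2 := by exact_mod_cast k1
  have k2' : -2 < k := by exact_mod_cast k2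
  have ne : ∀ {w w'}, (A w).radius < (A w').radius → w ≠ w' := by
    rintro w _ h rfl
    exact lt_irrefl _ h
  have block : ∀ w φ t, w ≠ u → w ≠ v → α ≤ φ → (A w).radius * Complex.exp (φ * Complex.I) =
      t * Complex.exp (θ * Complex.I) →
      t * Complex.exp (θ * Complex.I) ∈ segment ℝ ((A u).radius * Complex.exp (θ * Complex.I))
        ((A v).radius * Complex.exp ((θ + k * Real.pi : ℝ) * Complex.I)) → (A w).posArg < φ := by
    intro w φ t hwu hwv hφ e hs
    by_contra! hle
    exact hk w ⟨hwu, hwv, _, (A w).polar_mem_points ((hα w).trans_le hφ) hle, by rwa [e]⟩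
  have hur := (A u).radius_pos
  have hvr := (A v).radius_pos
  obtain rfl | rfl | rfl : k = 0 ∨ k = 1 ∨ k = -1 := by omega
  · left
    intro w h1 h2
    have h3 := block w θ (A w).radius (ne h1).symm (ne h2) hθ.1 rfl (by
      rw [Int.cast_zero, zero_mul, add_zero]
      refine mem_segment_ofReal_mul.2 ⟨_, ?_, rfl⟩
      rw [segment_eq_Icc hr.le]
      exact ⟨h1.le, h2.le⟩)
    simp only [Int.cast_zero, zero_mul, add_zero] at hψ
    exact ⟨by linarith, by linarith⟩
  · rw [Int.cast_one, one_mul] at block hψ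
    rw [neg_ofReal_mul_exp_add_pi] at block
    have seg : segment ℝ (A u).radius (-(A v).radius) =
        Set.Icc (-(A v).radius) (A u).radius := by
      rw [segment_symm, segment_eq_Icc (by linarith)]
    have inner : ∀ w, (A w).radius < (A u).radius → (A w).posArg < θ := fun w h =>
      block w θ (A w).radius (ne h) (ne (h.trans hr)) hθ.1 rfl
        (mem_segment_ofReal_mul.2 ⟨_, seg ▸ ⟨by linarith [(A w).radius_pos], h.le⟩, rfl⟩)
    have outer : ∀ w, w ≠ u → (A w).radius < (A v).radius → (A w).posArg < θ + Real.pi :=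
      fun w hwu h => block w (θ + Real.pi) (-(A w).radius : ℝ) hwu (ne h) (by linarith)
        (neg_ofReal_mul_exp_add_pi _ _)
        (mem_segment_ofReal_mul.2 ⟨_, seg ▸ ⟨by linarith, by linarith [(A w).radius_pos]⟩, rfl⟩)
    -- If `u` itself reaches the ray `θ + π`, it sees `v` along that ray.
    rcases lt_or_ge (A u).posArg (θ + Real.pi) with h | h
    · refine .inr ⟨θ, hθ.2, hψ.2, inner, fun w hw => ?_⟩
      rcases eq_or_ne w u with rfl | hwu
      · exact h
      · exact outer w hwu hw
    · left
      intro w h1 h2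
      have := outer w (ne h1).symm h2
      exact ⟨by linarith, by linarith [hψ.2]⟩
  -- Here `v` is met at `θ - π`, a ray which `u` also reaches, since it extends from `α` to at least
  -- `θ`.
  · left
    intro w h1 h2
    have e : ∀ r : ℝ, (r : ℂ) * Complex.exp ((θ + (-1 : ℤ) * Real.pi : ℝ) * Complex.I) =
        (-r : ℝ) * Complex.exp (θ * Complex.I) := by
      intro r
      have := neg_ofReal_mul_exp_add_pi (-r) (θ - Real.pi)
      rw [sub_add_cancel, neg_neg] at this
      rw [this]
      congr 4
      push_cast; ring
    have h3 := block w _ (-(A w).radius : ℝ) (ne h1).symm (ne h2) hψ.1 (e _) (by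
      rw [e]
      refine mem_segment_ofReal_mul.2 ⟨_, ?_, rfl⟩
      rw [segment_symm, segment_eq_Icc (by linarith)]
      exact ⟨by linarith, by linarith [(A w).radius_pos]⟩)
    push_cast at h3 hψ
    exact ⟨by linarith [hθ.2], by linarith [hψ.2]⟩

end

theorem IsSemiArcVisibilityGraph.isPlanar {V : Type*} {G : SimpleGraph V}
    (hG : IsSemiArcVisibilityGraph 0 G) : IsPlanar G := by
  obtain ⟨A, hA, ⟨α, hα⟩, rfl⟩ := hG
  have hinj := radius_injective_of_semiArc hA hα
  have hpos := fun v => (A v).radius_pos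
  have hx : ∀ u v, (A u).radius / (1 + (A u).radius) < (A v).radius / (1 + (A v).radius) ↔
      (A u).radius < (A v).radius := by
    intro u v
    rw [div_lt_div_iff₀ (by linarith [hpos u]) (by linarith [hpos v])]
    constructor <;> intro h <;> nlinarith
  -- `r / (1 + r)` preserves the order of radii and lands in `(0, 1)`, as the cylinder drawing
  -- demands.
  refine isPlanar_of_cylindrical _ (fun v => (A v).radius / (1 + (A v).radius)) ?_
    (fun v => div_pos (hpos v) (by linarith [hpos v]))
    (fun v => (div_lt_one (by linarith [hpos v])).2 (by linarith)) (DirectSight A)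
    (CentralSight A) ?_ ?_ ?_ ?_
  · intro u v h
    apply hinj
    dsimp only at h ⊢
    exact le_antisymm (not_lt.1 fun h' => ((hx v u).2 h').ne' h)
      (not_lt.1 fun h' => ((hx u v).2 h').ne h)
  · intro a b hab h
    exact directSight_or_centralSight hα ((hx a b).1 h) hab.2
  -- If direct sights interlaced, `c` would end before `b` and `b` before `c`.
  · rintro a b c d h h' ⟨h1, h2, h3⟩
    rw [hx] at h1 h2 h3
    exact lt_asymm (h c h1 h2).2 (h' b h2 h3).1
  -- The direct sight makes `d` end before `a`; the central sight makes `a`, of smaller radius than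
  -- `d`, end before `d`.
  · rintro a b c d h ⟨θ, -, hd, -, hin⟩ ⟨h1, h2⟩
    rw [hx] at h1 h2
    linarith [(h d h1 h2).1, hin a h1]
  -- For nested central sights the inner ends force `θ < θ'` and the outer ends `θ' < θ`.
  · rintro a b c d ⟨θ, ha, hb, hina, hinb⟩ ⟨θ', hc, hd, hinc, hind⟩ ⟨h1, h2⟩
    rw [hx] at h1 h2
    linarith [hinc a h1, hinb d h2]

theorem mainTheorem4 :
    (∀ (V : Type*) [Finite V] (G : SimpleGraph V),
      IsSemiArcVisibilityGraph 0 G → IsPlanar G) ∧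
    IsArcVisibilityGraph 0 (⊤ : SimpleGraph (Fin 5)) ∧
    ¬ IsPlanar (⊤ : SimpleGraph (Fin 5)) :=
  ⟨fun _ _ _ h => h.isPlanar, isArcVisibilityGraph_top_fin_five, not_isPlanar_top_fin_five⟩
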